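/- An abstract polytope of rank $n\ge -1$ is a partially ordered set $P$, possibly infinite, such that: (1) $P$ has a least element $0_P$ and a greatest element $1_P$; (2) every maximal chain of $P$ has exactly $n+2$ elements, which gives a rank function $\mathrm{rank}_P\colon P\to\{-1,0,\dots,n\}$ with $\mathrm{rank}_P(0_P)=-1$ and $\mathrm{rank}_P(1_P)=n$; (3) for all $F\le G$ in $P$ with $\mathrm{rank}_P(G)-\mathrm{rank}_P(F)>2$ and all $F',G'$ with $F<F',G'<G$ there is a finite sequence $F'=H^0,H^1,\dots,H^m=G'$ with $F<H^i<G$ for all $i$ and with $H^i\le H^{i+1}$ or $H^{i+1}\le H^i$ for all $i<m$; (4) for all $F\le G$ in $P$ with $\mathrm{rank}_P(G)-\mathrm{rank}_P(F)=2$ there are exactly two elements $H$ with $F<H<G$. The one-element poset is the abstract polytope of rank $-1$. Let $pt$ and $I$ denote the abstract polytopes of rank $0$ and $1$, each unique up to isomorphism. For abstract polytopes $P,Q$, the join $P*Q$ is the set of all pairs $(F,G)$ with $F\in P$, $G\in Q$, and the Cartesian product $P\times Q$ is the set of all pairs $(F,G)$ with $F\neq 0_P$ and $G\neq 0_Q$,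 together with the pair $(0_P,0_Q)$; both are ordered componentwise. Write $pt^{*k}$ and $I^{\times k}$ for the $k$-fold join of $pt$ and the $k$-fold Cartesian product of $I$. An abstract polytope is a pyramid if it is isomorphic to $Q*pt$ for some abstract polytope $Q$ of rank at least $-1$, and a prism if it is isomorphic to $Q\times I$ for some abstract polytope $Q$ of rank at least $-1$. Let $\mathrm{Aut}(P)$ be the group of order automorphisms of $P$. **Proposition.** Let $P$ be an abstract polytope. If $P$ is not a pyramid, then $$\mathrm{Aut}(P*pt^{*k})\cong \mathrm{Aut}(P)\times \mathrm{Sym}(k)\qquad\text{for every } k\ge 1.$$ If $P$ is not a prism, then $$\mathrm{Aut}(P\times I^{\times k})\cong \mathrm{Aut}(P)\times\bigl((\mathbb Z/2\mathbb Z)^k\rtimes \mathrm{Sym}(k)\bigr)\qquad\text{for every } k\ge 1,$$ where $\mathrm{Sym}(k)$ acts on $(\mathbb Z/2\mathbb Z)^k$ by permuting the coordinates. -/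

import Mathlib

universe u v

namespace AbsPolytope

/-- The rank of an element of a poset in which all chains have bounded finite length: the number
of steps in a longest chain ending at it, minus one (so a least element has rank `-1`). -/
noncomputable def rank {P : Type u} [Preorder P] (F : P) : ℤ :=
  ((Order.height F).toNat : ℤ) - 1

/-- Connectedness of the section `G / F`: either its rank difference is at most `2`, or any two
of its proper elements are joined by a sequence of proper elements of the section in which
consecutive ones are incident. -/
def SectionConnected {P : Type u} [PartialOrder P] (F G : P) : Prop :=
  rank G - rank F ≤ 2 ∨
    ∀ F' G' : Set.Ioo F G,
      Relation.ReflTransGen (fun H H' : Set.Ioo F G => H ≤ H' ∨ H' ≤ H) F' G'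

/-- A bounded poset is an abstract polytope of rank `n` (`n ≥ -1` is automatic; the one-element
poset has rank `-1`). Polytopes are not required to be finite. -/
structure IsAbstractPolytope (P : Type u) [PartialOrder P] [BoundedOrder P] (n : ℤ) : Prop where
  /-- every maximal chain has exactly `n + 2` elements -/
  flag_card : ∀ s : Flag P, (s : Set P).Finite ∧ ((s : Set P).ncard : ℤ) = n + 2
  /-- every section, including the whole poset, is connected -/
  connected : ∀ F G : P, F ≤ G → SectionConnected F G
  /-- the diamond condition -/
  diamond : ∀ F G : P, F ≤ G → rank G - rank F = 2 → (Set.Ioo F G).ncard = 2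

/-- The polytope of rank `0`: the subsets of a one-element vertex set. -/
abbrev Pt : Type := Finset (Fin 1)

/-- The polytope of rank `1`: the subsets of a two-element vertex set. -/
abbrev Edge : Type := Finset (Fin 2)

/-- The join: all pairs, ordered componentwise. -/
abbrev Join (P : Type u) (Q : Type v) : Type (max u v) := P × Q

/-- The `k`-fold join of `P` with itself: all `k`-tuples, ordered componentwise. -/
abbrev JoinPow (P : Type u) (k : ℕ) : Type u := Fin k → P

/-- The Cartesian product: the pairs of elements of rank at least `0`, that is, different from the
least element, together with the pair of the two least elements. -/
def CartProd (P : Type u) (Q : Type v) [Bot P] [Bot Q] : Type (max u v) :=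
  {x : P × Q // (x.1 ≠ ⊥ ∧ x.2 ≠ ⊥) ∨ x = (⊥, ⊥)}

/-- The Cartesian product is ordered componentwise. -/
instance {P : Type u} {Q : Type v} [PartialOrder P] [PartialOrder Q] [Bot P] [Bot Q] :
    PartialOrder (CartProd P Q) :=
  inferInstanceAs (PartialOrder {x : P × Q // (x.1 ≠ ⊥ ∧ x.2 ≠ ⊥) ∨ x = (⊥, ⊥)})

/-- The `k`-fold Cartesian product of `P` with itself (`k ≥ 1`): the `k`-tuples of elements of rank
at least `0`, together with the tuple of least elements. -/
def CartPow (P : Type u) [Bot P] (k : ℕ) : Type u :=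
  {x : Fin k → P // (∀ i, x i ≠ ⊥) ∨ x = fun _ => ⊥}

/-- The `k`-fold Cartesian product is ordered componentwise. -/
instance {P : Type u} [PartialOrder P] [Bot P] (k : ℕ) : PartialOrder (CartPow P k) :=
  inferInstanceAs (PartialOrder {x : Fin k → P // (∀ i, x i ≠ ⊥) ∨ x = fun _ => ⊥})

instance {P : Type u} [Bot P] (k : ℕ) : Bot (CartPow P k) := ⟨⟨fun _ => ⊥, Or.inr rfl⟩⟩

/-- `P` is a pyramid: it is isomorphic to `Q * pt` for some abstract polytope `Q` (of any rank
`m ≥ -1`). -/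
def IsPyramid (P : Type u) [PartialOrder P] : Prop :=
  ∃ (Q : Type u) (_ : PartialOrder Q) (_ : BoundedOrder Q) (m : ℤ),
    IsAbstractPolytope Q m ∧ Nonempty (P ≃o Join Q Pt)

/-- `P` is a prism: it is isomorphic to `Q × I` for some abstract polytope `Q` (of any rank
`m ≥ -1`). -/
def IsPrism (P : Type u) [PartialOrder P] : Prop :=
  ∃ (Q : Type u) (_ : PartialOrder Q) (_ : BoundedOrder Q) (m : ℤ),
    IsAbstractPolytope Q m ∧ Nonempty (P ≃o CartProd Q Edge)

/-- The automorphism group of a poset, under composition. -/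
abbrev Aut (P : Type u) [PartialOrder P] : Type u := P ≃o P

/-- The group `(ℤ/2)^k ⋊ Sym(k)`, where `Sym(k)` permutes the `k` coordinates. -/
abbrev SignedPerm (k : ℕ) : Type :=
  SemidirectProduct (Fin k → Multiplicative (ZMod 2)) (Equiv.Perm (Fin k)) mulAutArrow

/-! The tuple description of the powers agrees with iterating the binary products. -/

/-- `P^{*1} ≅ P`. -/
theorem joinPow_one (P : Type u) [PartialOrder P] : Nonempty (JoinPow P 1 ≃o P) :=
  ⟨OrderIso.funUnique (Fin 1) P⟩

/-- `P^{*(k+1)} ≅ P * P^{*k}`. -/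
theorem joinPow_succ (P : Type u) [PartialOrder P] (k : ℕ) :
    Nonempty (JoinPow P (k + 1) ≃o Join P (JoinPow P k)) :=
  ⟨(Fin.consOrderIso (fun _ => P)).symm⟩

/-- `P^{×1} ≅ P`. -/
theorem cartPow_one (P : Type u) [PartialOrder P] [Bot P] : Nonempty (CartPow P 1 ≃o P) := by
  refine ⟨⟨⟨fun x => x.1 0, fun p => ⟨fun _ => p, ?_⟩, ?_, ?_⟩, ?_⟩⟩
  · by_cases h : p = ⊥
    · exact Or.inr (by rw [h])
    · exact Or.inl fun _ => h
  · intro x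
    apply Subtype.ext
    funext i
    rw [Subsingleton.elim i 0]
  · intro p
    rfl
  · intro x y
    refine ⟨fun h i => ?_, fun h => h 0⟩
    rw [Subsingleton.elim i 0]
    exact h

/-- `P^{×(k+1)} ≅ P × P^{×k}` for `k ≥ 1`. -/
theorem cartPow_succ (P : Type u) [PartialOrder P] [Bot P] (k : ℕ) (hk : 1 ≤ k) :
    Nonempty (CartPow P (k + 1) ≃o CartProd P (CartPow P k)) := by
  have key : ∀ y : CartPow P k, y ≠ ⊥ → ∀ i, y.1 i ≠ ⊥ := fun y hy =>
    y.2.resolve_right fun h => hy (Subtype.ext h)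
  refine ⟨⟨⟨fun x => ⟨(x.1 0, ⟨fun i => x.1 i.succ, ?_⟩), ?_⟩,
    fun y => ⟨Fin.cons y.1.1 y.1.2.1, ?_⟩, ?_, ?_⟩, ?_⟩⟩
  · rcases x.2 with h | h
    · exact Or.inl fun i => h i.succ
    · exact Or.inr (by rw [h])
  · rcases x.2 with h | h
    · refine Or.inl ⟨h 0, fun h' => ?_⟩
      exact h (Fin.succ ⟨0, hk⟩) (congrFun (congrArg Subtype.val h') ⟨0, hk⟩)
    · refine Or.inr (Prod.ext (by simp [h]) (Subtype.ext ?_))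
      funext i
      simp only [h]
      rfl
  · rcases y.2 with h | h
    · exact Or.inl (Fin.cases h.1 (key _ h.2))
    · refine Or.inr ?_
      rw [h]
      funext i
      refine Fin.cases rfl (fun j => rfl) i
  · intro x
    exact Subtype.ext (Fin.cons_self_tail x.1)
  · intro y
    rfl
  · intro x y
    refine ⟨fun h i => ?_, fun h => ⟨h 0, fun i => h i.succ⟩⟩
    exact Fin.cases h.1 (fun j => h.2 j) i

end AbsPolytope

namespace AbsPolytope

/-! Both statements are one statement about a poset `A × (ι → L)`, where `L` is a nonempty antichain
with a top added (`IsClaw`). For the join, `A = P` and `L = Pt`. For the Cartesian product, discard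
the least elements, which every automorphism fixes: `A` is `P` without `⊥`, and `L` is an edge
without its empty face.

An automorphism permutes the coatoms, among them the facets "coordinate `i` equals `d`". If it moved
all facets of one direction `i` into the `A` direction, pulling back an interval isomorphic to `A`
would give a lower interval with a factor `L`, so `A ≃o B × L`, and `P` would be a pyramid or a
prism (`exists_apply_facet_ne_top`). Hence some facet of direction `i` keeps an `L` direction `j`;
facets of one direction are disjoint, so the others follow it (`exists_apply_facet`). This yields a
permutation of `ι` and automorphisms of `L`. Once these are divided out, the automorphism preserves
each fibre `A × {y}`, and the finite chain length forces it to act alike on all of them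
(`exists_apply_eq_of_apply_snd`). -/

theorem IsAbstractPolytope.wellFoundedGT {P : Type u} [PartialOrder P] [BoundedOrder P] {n : ℤ}
    (hP : IsAbstractPolytope P n) : WellFoundedGT P := by
  rw [WellFoundedGT, isWellFounded_iff, RelEmbedding.wellFounded_iff_isEmpty]
  refine ⟨fun a => ?_⟩
  -- A failure of well-foundedness is a strictly increasing sequence, hence an infinite chain inside
  -- some flag.
  have hmono : StrictMono a := fun m k h => (a.map_rel_iff (a := k) (b := m)).2 h
  have hc : IsChain (· ≤ ·) (Set.range a) := by
    rintro _ ⟨m, rfl⟩ _ ⟨k, rfl⟩ -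
    exact (le_total m k).imp (fun h => hmono.monotone h) (fun h => hmono.monotone h)
  obtain ⟨s, hs⟩ := hc.exists_subset_flag
  exact Set.infinite_range_of_injective a.injective ((hP.flag_card s).1.subset hs)

/-! ### Lower intervals of polytopes -/

section LowerSet

variable {P Q : Type u} [PartialOrder P] [PartialOrder Q] (i : Q ↪o P)

/-- Height depends only on the elements below, and a lower set contains all of them. -/
theorem rank_of_isLowerSet_range (hi : IsLowerSet (Set.range i)) (q : Q) :
    rank (i q) = rank q := by
  unfold rank
  rw [← Order.height_eq_of_strictMono i i.strictMono (fun a b hb => ?_) q]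
  obtain ⟨a', rfl⟩ := hi hb.le ⟨a, rfl⟩
  exact ⟨a', i.lt_iff_lt.1 hb, rfl⟩

theorem image_Ioo_of_isLowerSet_range (hi : IsLowerSet (Set.range i)) (F G : Q) :
    i '' Set.Ioo F G = Set.Ioo (i F) (i G) := by
  ext x
  constructor
  · rintro ⟨y, hy, rfl⟩
    exact ⟨i.lt_iff_lt.2 hy.1, i.lt_iff_lt.2 hy.2⟩
  · rintro ⟨h₁, h₂⟩
    obtain ⟨y, rfl⟩ := hi h₂.le ⟨G, rfl⟩
    exact ⟨y, ⟨i.lt_iff_lt.1 h₁, i.lt_iff_lt.1 h₂⟩, rfl⟩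

/-- A poset that is isomorphic to a lower interval of an abstract polytope is an abstract
polytope. -/
theorem IsAbstractPolytope.exists_of_isLowerSet_range [BoundedOrder P] [BoundedOrder Q] {n : ℤ}
    (hP : IsAbstractPolytope P n) (hi : IsLowerSet (Set.range i)) :
    ∃ m, IsAbstractPolytope Q m := by
  -- One fixed flag `T` of the interval above `i ⊤` completes every flag of `Q` to a flag of `P`.
  obtain ⟨t, -⟩ := (Set.subsingleton_empty.isChain (r := (· ≤ ·)) (α := Set.Ici (i ⊤))).exists_subset_flag
  let T : Set P := Subtype.val '' (t : Set (Set.Ici (i ⊤)))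
  have hT : ∀ x ∈ T, i ⊤ ≤ x := by
    rintro _ ⟨x, -, rfl⟩
    exact x.2
  have hiT : i ⊤ ∈ T :=
    ⟨⟨i ⊤, Set.self_mem_Ici⟩, t.mem_iff_forall_le_or_ge.2 fun b _ => Or.inl b.2, rfl⟩
  have hflag : ∀ s : Flag Q, IsMaxChain (· ≤ ·) (i '' (s : Set Q) ∪ T) := by
    intro s
    refine ⟨?_, fun c hc hsc => hsc.antisymm fun x hx => ?_⟩
    · rintro _ (⟨x, hx, rfl⟩ | ⟨x, hx, rfl⟩) _ (⟨y, hy, rfl⟩ | ⟨y, hy, rfl⟩) -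
      · exact (s.le_or_le hx hy).imp i.le_iff_le.2 i.le_iff_le.2
      · exact Or.inl ((i.le_iff_le.2 le_top).trans y.2)
      · exact Or.inr ((i.le_iff_le.2 le_top).trans x.2)
      · exact t.le_or_le hx hy
    · rcases hc.total hx (hsc (Or.inr hiT)) with h | h
      · obtain ⟨y, rfl⟩ := hi h ⟨⊤, rfl⟩
        refine Or.inl ⟨y, s.mem_iff_forall_le_or_ge.2 fun b hb => ?_, rfl⟩
        exact (hc.total hx (hsc (Or.inl ⟨b, hb, rfl⟩))).imp i.le_iff_le.1 i.le_iff_le.1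
      · refine Or.inr ⟨⟨x, h⟩, t.mem_iff_forall_le_or_ge.2 fun b hb => ?_, rfl⟩
        exact hc.total hx (hsc (Or.inr ⟨b, hb, rfl⟩))
  -- The element `i ⊤` is counted in both pieces, so a flag of `Q` has `n + 2 + 1 - T.ncard`
  -- elements.
  refine ⟨n + 1 - T.ncard, fun s => ?_, fun F G hFG => ?_, fun F G hFG h => ?_⟩
  · obtain ⟨hfin, hcard⟩ := hP.flag_card (Flag.ofIsMaxChain _ (hflag s))
    rw [Flag.coe_ofIsMaxChain] at hfin hcard
    have hs := (hfin.subset Set.subset_union_left)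
    have hTf := (hfin.subset Set.subset_union_right)
    refine ⟨hs.of_finite_image i.injective.injOn, ?_⟩
    have hint : i '' (s : Set Q) ∩ T = {i ⊤} := by
      refine Set.Subset.antisymm ?_ (Set.singleton_subset_iff.2 ⟨⟨⊤, s.top_mem, rfl⟩, hiT⟩)
      rintro _ ⟨⟨x, -, rfl⟩, hx⟩
      exact le_antisymm (i.le_iff_le.2 le_top) (hT _ hx)
    have := Set.ncard_union_add_ncard_inter (i '' (s : Set Q)) T hs hTf
    rw [hint, Set.ncard_singleton, Set.ncard_image_of_injective _ i.injective] at this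
    omega
  · rcases hP.connected (i F) (i G) (i.le_iff_le.2 hFG) with h | h
    · rw [rank_of_isLowerSet_range i hi, rank_of_isLowerSet_range i hi] at h
      exact Or.inl h
    · refine Or.inr fun F' G' => ?_
      have him := image_Ioo_of_isLowerSet_range i hi F G
      have hmem : ∀ x : Set.Ioo (i F) (i G), ∃ y : Set.Ioo F G, i y = x := fun x => by
        obtain ⟨y, hy, hyx⟩ := him.ge x.2
        exact ⟨⟨y, hy⟩, hyx⟩
      choose r hr using hmem
      have hr' : ∀ (x : Set.Ioo F G) hx, r ⟨i x, hx⟩ = x := fun x hx =>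
        Subtype.ext (i.injective (hr _))
      have := (h ⟨i F', him.le ⟨F', F'.2, rfl⟩⟩ ⟨i G', him.le ⟨G', G'.2, rfl⟩⟩).lift
        (p := fun H H' : Set.Ioo F G => H ≤ H' ∨ H' ≤ H) r fun a b hab => by
          refine hab.imp (fun h => ?_) (fun h => ?_)
          · exact i.le_iff_le.1 (by rw [hr, hr]; exact h)
          · exact i.le_iff_le.1 (by rw [hr, hr]; exact h)
      rwa [Function.onFun, hr', hr'] at this
  · rw [← rank_of_isLowerSet_range i hi, ← rank_of_isLowerSet_range i hi] at h
    rw [← hP.diamond _ _ (i.le_iff_le.2 hFG) h, ← image_Ioo_of_isLowerSet_range i hi,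
      Set.ncard_image_of_injective _ i.injective]

end LowerSet

/-- A monotone self-map above the identity of a poset without infinite ascending chains is the
identity if it is injective. -/
theorem eq_self_of_le_of_injective {A : Type*} [PartialOrder A] [WellFoundedGT A] {h : A → A}
    (hinj : Function.Injective h) (hle : ∀ a, a ≤ h a) (a : A) : h a = a := by
  induction a using WellFoundedGT.induction with
  | ind a ih =>
    by_contra hne
    exact hne (hinj (ih (h a) (lt_of_le_of_ne (hle a) (Ne.symm hne))))

/-- A poset in which a greatest element has been added to a nonempty antichain. -/
structure IsClaw (L : Type*) [PartialOrder L] [OrderTop L] : Prop where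
  exists_ne_top : ∃ d : L, d ≠ ⊤
  eq_of_le : ∀ {x y : L}, x ≤ y → y ≠ ⊤ → x = y

/-! ### How automorphisms of `A × (ι → L)` move the facets in the `L` directions -/

section Facets

variable {A : Type u} {ι L : Type} [PartialOrder A] [OrderTop A] [PartialOrder L] [OrderTop L]
  [DecidableEq ι]

/-- The element of `A × (ι → L)` all of whose coordinates are the greatest elements, except for
the coordinate `i`, which is `l`. -/
def facet (A : Type u) [PartialOrder A] [OrderTop A] (i : ι) (l : L) : A × (ι → L) :=
  (⊤, Function.update ⊤ i l)

theorem le_facet {i : ι} {l : L} {x : A × (ι → L)} : x ≤ facet A i l ↔ x.2 i ≤ l := by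
  simp [facet, Prod.le_def, le_update_iff]

@[simp]
theorem facet_top (i : ι) : facet A i (⊤ : L) = ⊤ := by
  exact Prod.ext rfl (Function.update_eq_self i (⊤ : ι → L))

theorem facet_le_facet {i : ι} {l l' : L} : facet A i l ≤ facet A i l' ↔ l ≤ l' := by
  rw [le_facet]
  simp [facet]

theorem facet_eq_top {i : ι} {l : L} : facet A i l = ⊤ ↔ l = ⊤ := by
  rw [← top_le_iff, ← facet_top i, facet_le_facet, top_le_iff]

theorem IsClaw.eq_of_facet_le (hL : IsClaw L) {i : ι} {d : L} {x : A × (ι → L)}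
    (h : facet A i d ≤ x) (hx : x ≠ ⊤) : x = facet A i d := by
  have h1 : x.1 = ⊤ := top_le_iff.1 h.1
  have h2 : ∀ j, j ≠ i → x.2 j = ⊤ := fun j hj => by
    have := h.2 j
    simpa [facet, hj] using this
  have h3 : d ≤ x.2 i := by simpa [facet] using h.2 i
  have h4 : x.2 i ≠ ⊤ := fun h' => hx (Prod.ext h1 (funext fun j => by
    by_cases hj : j = i
    · rw [hj, h']; rfl
    · rw [h2 j hj]; rfl))
  refine Prod.ext h1 (funext fun j => ?_)
  by_cases hj : j = i
  · subst hj
    simp [facet, hL.eq_of_le h3 h4]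
  · simp [facet, hj, h2 j hj]

omit [OrderTop A] in
/-- Splitting off the coordinate `i` from a lower interval. -/
theorem IsClaw.nonempty_Iic_orderIso_prod (hL : IsClaw L) (z : A × (ι → L)) {i : ι}
    (hz : z.2 i = ⊤) :
    ∃ w : A × (ι → L), Nonempty (Set.Iic z ≃o Set.Iic w × L) := by
  obtain ⟨d, hd⟩ := hL.exists_ne_top
  -- Freezing coordinate `i` at the minimal `d` leaves it no freedom below the new element, while
  -- `z.2 i = ⊤` lets it range over all of `L`.
  refine ⟨(z.1, Function.update z.2 i d), ⟨⟨⟨fun x =>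
    (⟨(x.1.1, Function.update x.1.2 i d), x.2.1, ?_⟩, x.1.2 i),
    fun x => ⟨(x.1.1.1, Function.update x.1.1.2 i x.2), x.1.2.1, ?_⟩, ?_, ?_⟩, ?_⟩⟩⟩
  · exact update_le_update_iff.2 ⟨le_rfl, fun j _ => x.2.2 j⟩
  · intro j
    by_cases hj : j = i
    · subst hj
      simp [hz]
    · have := x.1.2.2 j
      simpa [hj] using this
  · intro x
    simp
  · rintro ⟨⟨x, hx⟩, l⟩
    have : x.2 i = d := hL.eq_of_le (by simpa using hx.2 i) hd
    simp [← this]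
  · rintro ⟨x, hx⟩ ⟨y, hy⟩
    simp only [Equiv.coe_fn_mk, Prod.le_def, Subtype.mk_le_mk]
    constructor
    · rintro ⟨⟨h1, h2⟩, h3⟩
      refine ⟨h1, fun j => ?_⟩
      by_cases hj : j = i
      · exact hj ▸ h3
      · simpa [hj] using h2 j
    · rintro ⟨h1, h2⟩
      exact ⟨⟨h1, update_le_update_iff.2 ⟨le_rfl, fun j _ => h2 j⟩⟩, h2 i⟩

omit [DecidableEq ι] in
/-- If all coordinates of `y` are minimal, then the interval below `(⊤, y)` is isomorphic to `A`. -/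
theorem IsClaw.nonempty_orderIso_Iic (hL : IsClaw L) {y : ι → L} (hy : ∀ i, y i ≠ ⊤) :
    Nonempty (A ≃o Set.Iic ((⊤, y) : A × (ι → L))) :=
  ⟨⟨⟨fun a => ⟨(a, y), le_top, le_rfl⟩, fun x => x.1.1, fun _ => rfl, fun x =>
    Subtype.ext (Prod.ext rfl (funext fun i => (hL.eq_of_le (x.2.2 i) (hy i)).symm))⟩,
    ⟨fun h => h.1, fun h => ⟨h, le_rfl⟩⟩⟩⟩

/-- Otherwise no facet of direction `i` has an image above `(⊤, d, …, d)`, whose lower interval is a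
copy of `A`. Its preimage then has `i`-th coordinate `⊤`, so a factor `L` splits off from `A`. -/
theorem exists_apply_facet_ne_top (hL : IsClaw L)
    (hA : ∀ (B : Type u) [PartialOrder B] [OrderTop B], IsEmpty (A ≃o B × L))
    (φ : (A × (ι → L)) ≃o (A × (ι → L))) (i : ι) :
    ∃ d : L, d ≠ ⊤ ∧ (φ (facet A i d)).2 ≠ ⊤ := by
  by_contra! h
  obtain ⟨d, hd⟩ := hL.exists_ne_top
  obtain ⟨e⟩ := hL.nonempty_orderIso_Iic (A := A) (y := fun _ : ι => d) (fun _ => hd)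
  have hz : (φ.symm (⊤, fun _ => d)).2 i = ⊤ := by
    by_contra hne
    have h1 : φ.symm (⊤, fun _ => d) ≤ facet A i _ := le_facet.2 le_rfl
    rw [OrderIso.symm_apply_le] at h1
    have h2 := h _ hne
    have h3 : φ (facet A i ((φ.symm (⊤, fun _ => d)).2 i)) = ⊤ :=
      Prod.ext (top_le_iff.1 h1.1) h2
    rw [map_eq_top_iff, facet_eq_top] at h3
    exact hne h3
  obtain ⟨w, ⟨f⟩⟩ := hL.nonempty_Iic_orderIso_prod _ hz
  have : Nonempty (Set.Iic ((⊤, fun _ => d) : A × (ι → L)) ≃o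
      Set.Iic (φ.symm (⊤, fun _ => d))) :=
    ⟨⟨⟨fun x => ⟨φ.symm x.1, φ.symm.monotone x.2⟩,
      fun x => ⟨φ x.1, (OrderIso.le_symm_apply φ).1 x.2⟩,
      fun x => by simp, fun x => by simp⟩, φ.symm.le_iff_le⟩⟩
  obtain ⟨g⟩ := this
  exact (hA (Set.Iic w)).false (e.trans (g.trans f))

theorem exists_apply_facet (hL : IsClaw L)
    (hA : ∀ (B : Type u) [PartialOrder B] [OrderTop B], IsEmpty (A ≃o B × L))
    (φ : (A × (ι → L)) ≃o (A × (ι → L))) (i : ι) :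
    ∃ j : ι, ∀ d : L, ∃ d' : L, φ (facet A i d) = facet A j d' := by
  have key : ∀ d, (φ (facet A i d)).2 ≠ ⊤ →
      ∃ j, ∃ d' : L, d' ≠ ⊤ ∧ φ (facet A i d) = facet A j d' := by
    intro d h
    obtain ⟨j, hj⟩ := Function.ne_iff.1 h
    refine ⟨j, _, hj, ?_⟩
    have h1 : φ (facet A i d) ≤ facet A j _ := le_facet.2 le_rfl
    rw [← OrderIso.le_symm_apply] at h1
    have := hL.eq_of_facet_le h1 (by
      rw [Ne, map_eq_top_iff, facet_eq_top]
      exact hj)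
    exact (φ.symm_apply_eq.1 this).symm
  obtain ⟨d₀, hd₀, h₀⟩ := exists_apply_facet_ne_top hL hA φ i
  obtain ⟨j, d₀', hd₀', e₀⟩ := key d₀ h₀
  refine ⟨j, fun d => ?_⟩
  by_cases hd : d = ⊤
  · exact ⟨⊤, by rw [hd, facet_top, facet_top, map_top]⟩
  by_cases hdd : d = d₀
  · exact ⟨d₀', hdd ▸ e₀⟩
  -- Distinct minimal elements of `L` have no common lower bound, so the two facets, and hence their
  -- images, have none.
  have disj : ∀ x, x ≤ φ (facet A i d) → x ≤ φ (facet A i d₀) → False := by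
    intro x h1 h2
    rw [← OrderIso.symm_apply_le, le_facet] at h1 h2
    exact hdd ((hL.eq_of_le h1 hd).symm.trans (hL.eq_of_le h2 hd₀))
  rw [e₀] at disj
  -- An image with second component `⊤` would have a common lower bound with `facet A j d₀'`.
  have hne : (φ (facet A i d)).2 ≠ ⊤ := by
    intro h
    refine disj ((φ (facet A i d)).1, Function.update ⊤ j d₀') ⟨le_rfl, ?_⟩ ⟨le_top, le_rfl⟩
    rw [h]
    exact le_top
  obtain ⟨j', d', hd', e'⟩ := key d hne
  by_cases hjj : j' = j
  · exact ⟨d', hjj ▸ e'⟩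
  · rw [e'] at disj
    -- Facets of different directions meet: prescribe both coordinates at once.
    refine (disj (⊤, Function.update (Function.update ⊤ j d₀') j' d') (le_facet.2 (by simp))
      (le_facet.2 ?_)).elim
    simp [Ne.symm hjj]

/-- An automorphism of `A × (ι → L)` permutes the coordinates in `L`. -/
theorem exists_perm_apply_snd (hL : IsClaw L)
    (hA : ∀ (B : Type u) [PartialOrder B] [OrderTop B], IsEmpty (A ≃o B × L))
    (φ : (A × (ι → L)) ≃o (A × (ι → L))) :
    ∃ (σ : Equiv.Perm ι) (g : ι → (L ≃o L)), ∀ x i, (φ x).2 (σ i) = g i (x.2 i) := by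
  choose s g hg using exists_apply_facet hL hA φ
  choose s' g' hg' using exists_apply_facet hL hA φ.symm
  -- All `facet A i ⊤` coincide, so directions can be read off only from facets at a non-top `d`.
  obtain ⟨d, hd⟩ := hL.exists_ne_top
  have inj : ∀ {i j : ι} {l m : L}, l ≠ ⊤ → facet A i l = facet A j m → i = j ∧ l = m := by
    intro i j l m hl h
    have h1 : (facet A i l).2 i = (facet A j m).2 i := by rw [h]
    have hij : i = j := by
      by_contra hij
      simp [facet, hij] at h1
      exact hl h1
    subst hij
    exact ⟨rfl, by simpa [facet] using h1⟩
  have h1 : ∀ i l, s' (s i) = i ∧ g' (s i) (g i l) = l := by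
    intro i l
    have h : ∀ l, facet A i l = facet A (s' (s i)) (g' (s i) (g i l)) := fun l => by
      rw [← hg', ← hg, OrderIso.symm_apply_apply]
    have hi := (inj hd (h d)).1
    refine ⟨hi.symm, ?_⟩
    have := h l
    rw [← hi] at this
    exact le_antisymm (facet_le_facet.1 this.ge) (facet_le_facet.1 this.le)
  have h2 : ∀ i l, s (s' i) = i ∧ g (s' i) (g' i l) = l := by
    intro i l
    have h : ∀ l, facet A i l = facet A (s (s' i)) (g (s' i) (g' i l)) := fun l => by
      rw [← hg, ← hg', OrderIso.apply_symm_apply]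
    have hi := (inj hd (h d)).1
    refine ⟨hi.symm, ?_⟩
    have := h l
    rw [← hi] at this
    exact le_antisymm (facet_le_facet.1 this.ge) (facet_le_facet.1 this.le)
  refine ⟨⟨s, s', fun i => (h1 i d).1, fun i => (h2 i d).1⟩, fun i =>
    ⟨⟨g i, g' (s i), fun l => (h1 i l).2, fun l => ?_⟩, ?_⟩, fun x i => ?_⟩
  · have := (h2 (s i) l).2
    rwa [(h1 i d).1] at this
  · intro l m
    change g i l ≤ g i m ↔ l ≤ m
    rw [← facet_le_facet (A := A) (i := s i), ← hg, ← hg, OrderIso.le_iff_le, facet_le_facet]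
  -- A coordinate is determined by the facets lying above the element, and `φ` transports these.
  · have h : ∀ m, (φ x).2 (s i) ≤ m ↔ x.2 i ≤ g' (s i) m := by
      intro m
      rw [← le_facet (A := A), ← OrderIso.le_symm_apply, hg', (h1 i d).1, le_facet]
    change (φ x).2 (s i) = g i (x.2 i)
    have h3 := (h (g i (x.2 i))).2 (by rw [(h1 i _).2])
    by_cases h4 : g i (x.2 i) = ⊤
    · have h5 : x.2 i = ⊤ := by
        have := hg i (x.2 i)
        rwa [h4, facet_top, map_eq_top_iff, facet_eq_top] at this
      have h6 := (h _).1 le_rfl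
      rw [h5, top_le_iff] at h6
      have := (h2 (s i) ((φ x).2 (s i))).2
      rw [← this, (h1 i d).1, h6, h5]
    · exact hL.eq_of_le h3 h4

end Facets

/-! ### The wreath product action and its bijectivity -/

section PowerAutomorphisms

variable {A : Type u} {ι L H : Type} [PartialOrder A] [PartialOrder L] [Group H]

/-- The product of two order isomorphisms. -/
def prodCongr {A B C D : Type*} [PartialOrder A] [PartialOrder B] [PartialOrder C]
    [PartialOrder D] (e : A ≃o B) (f : C ≃o D) : A × C ≃o B × D where
  toEquiv := e.toEquiv.prodCongr f.toEquiv
  map_rel_iff' := by simp [Prod.le_def]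

/-- The wreath product of a group acting on `L` and the symmetric group of `ι` acts, together with
the automorphisms of `A`, on `A × (ι → L)`. -/
def wreathHom (A : Type u) [PartialOrder A] (ι : Type) (θ : H →* Aut L) :
    Aut A × SemidirectProduct (ι → H) (Equiv.Perm ι) mulAutArrow →* Aut (A × (ι → L)) where
  toFun w :=
    { toFun := fun x => (w.1 x.1, fun j => θ (w.2.left j) (x.2 (w.2.right⁻¹ j)))
      invFun := fun x => (w.1.symm x.1, fun j => (θ (w.2.left (w.2.right j))).symm
        (x.2 (w.2.right j)))
      left_inv := fun x => by simp
      right_inv := fun x => by simp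
      map_rel_iff' := fun {x y} => by
        simp only [Equiv.coe_fn_mk, Prod.le_def, Pi.le_def, OrderIso.le_iff_le]
        refine and_congr_right fun _ => ⟨fun h i => ?_, fun h i => h _⟩
        simpa using h (w.2.right i) }
  map_one' := by
    ext x <;> simp
  map_mul' v w := by
    ext x j
    · rfl
    · change θ (v.2.left j * w.2.left (v.2.right⁻¹ j)) (x.2 ((v.2.right * w.2.right)⁻¹ j)) = _
      simp

theorem wreathHom_apply (θ : H →* Aut L)
    (w : Aut A × SemidirectProduct (ι → H) (Equiv.Perm ι) mulAutArrow) (x : A × (ι → L)) :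
    wreathHom A ι θ w x = (w.1 x.1, fun j => θ (w.2.left j) (x.2 (w.2.right⁻¹ j))) :=
  rfl

variable [OrderTop A] [OrderTop L]

theorem wreathHom_injective (hL : IsClaw L) {θ : H →* Aut L} (hθ : Function.Injective θ) :
    Function.Injective (wreathHom A ι θ) := by
  classical
  rw [injective_iff_map_eq_one]
  rintro ⟨f, v, σ⟩ h
  have h' : ∀ (a : A) (y : ι → L), f a = a ∧ ∀ j, θ (v j) (y (σ⁻¹ j)) = y j := fun a y => by
    have := DFunLike.congr_fun h (a, y)
    rw [wreathHom_apply] at this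
    exact ⟨congrArg Prod.fst this, fun j => congrFun (congrArg Prod.snd this) j⟩
  obtain ⟨d, hd⟩ := hL.exists_ne_top
  have hσ : σ = 1 := by
    ext i
    by_contra hi
    have := (h' ⊤ (Function.update ⊤ i d)).2 (σ i)
    rw [Function.update_of_ne (show σ i ≠ i from hi)] at this
    simp at this
    exact hd this
  subst hσ
  refine Prod.ext (DFunLike.ext _ _ fun a => (h' a ⊤).1) (SemidirectProduct.ext ?_ rfl)
  funext j
  refine hθ ?_
  change θ (v j) = θ 1
  rw [map_one]
  exact DFunLike.ext _ _ fun l => (h' ⊤ fun _ => l).2 j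

omit [OrderTop A] in
-- On the fibre over `y`, `ψ` acts by an automorphism `f_y` of `A`, and monotonicity gives `f_y ≤
-- f_⊤`. So `f_y⁻¹ ∘ f_⊤` is injective and lies above the identity, hence equals it.
theorem exists_apply_eq_of_apply_snd [WellFoundedGT A] (ψ : Aut (A × (ι → L)))
    (hψ : ∀ x, (ψ x).2 = x.2) : ∃ f : Aut A, ∀ x, ψ x = (f x.1, x.2) := by
  have hψ' : ∀ x, (ψ.symm x).2 = x.2 := fun x => by
    rw [← hψ, OrderIso.apply_symm_apply]
  have h1 : ∀ a y, ψ (a, y) = ((ψ (a, y)).1, y) := fun a y => Prod.ext rfl (hψ _)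
  have h2 : ∀ a y, ψ.symm (a, y) = ((ψ.symm (a, y)).1, y) := fun a y => Prod.ext rfl (hψ' _)
  have inv1 : ∀ a y, (ψ.symm ((ψ (a, y)).1, y)).1 = a := fun a y => by
    rw [← h1, OrderIso.symm_apply_apply]
  have inv2 : ∀ a y, (ψ ((ψ.symm (a, y)).1, y)).1 = a := fun a y => by
    rw [← h2, OrderIso.apply_symm_apply]
  let f : Aut A :=
    { toFun := fun a => (ψ (a, ⊤)).1
      invFun := fun a => (ψ.symm (a, ⊤)).1
      left_inv := fun a => inv1 a _
      right_inv := fun a => inv2 a _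
      map_rel_iff' := fun {a b} => by
        change (ψ (a, ⊤)).1 ≤ (ψ (b, ⊤)).1 ↔ a ≤ b
        have : ψ (a, ⊤) ≤ ψ (b, ⊤) ↔ (ψ (a, ⊤)).1 ≤ (ψ (b, ⊤)).1 := by
          rw [Prod.le_def, hψ, hψ]
          simp
        rw [← this, OrderIso.le_iff_le]
        simp }
  refine ⟨f, fun x => Prod.ext ?_ (hψ x)⟩
  obtain ⟨a, y⟩ := x
  have key : (ψ.symm ((ψ (a, ⊤)).1, y)).1 = a := by
    refine eq_self_of_le_of_injective (h := fun a => (ψ.symm ((ψ (a, ⊤)).1, y)).1) ?_ ?_ a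
    · intro a b hab
      have := congrArg (fun c => (ψ (c, y)).1) hab
      simp only [inv2] at this
      exact f.injective this
    · intro a
      have h3 : ((ψ (a, y)).1, y) ≤ ((ψ (a, ⊤)).1, y) :=
        ⟨(ψ.monotone (show (a, y) ≤ (a, ⊤) from ⟨le_rfl, le_top⟩)).1, le_rfl⟩
      have := (ψ.symm.monotone h3).1
      rwa [inv1] at this
  change (ψ (a, y)).1 = (ψ (a, ⊤)).1
  conv_lhs => rw [← key]
  exact inv2 _ _

theorem wreathHom_surjective [WellFoundedGT A] (hL : IsClaw L)
    (hA : ∀ (B : Type u) [PartialOrder B] [OrderTop B], IsEmpty (A ≃o B × L))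
    {θ : H →* Aut L} (hθ : Function.Surjective θ) :
    Function.Surjective (wreathHom A ι θ) := by
  classical
  intro φ
  obtain ⟨σ, g, h⟩ := exists_perm_apply_snd hL hA φ
  choose v hv using fun i => hθ (g i)
  let w : Aut A × SemidirectProduct (ι → H) (Equiv.Perm ι) mulAutArrow :=
    (1, ⟨fun j => v (σ⁻¹ j), σ⟩)
  have hw : ∀ x, (wreathHom A ι θ w x).2 = (φ x).2 := fun x => by
    funext j
    obtain ⟨i, rfl⟩ := σ.surjective j
    rw [wreathHom_apply, h]
    simp [w, hv]
  obtain ⟨f, hf⟩ := exists_apply_eq_of_apply_snd (φ * (wreathHom A ι θ w)⁻¹) fun x => by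
    rw [RelIso.mul_apply, ← hw, RelIso.apply_inv_self]
  refine ⟨(f, 1) * w, ?_⟩
  rw [map_mul, ← eq_mul_inv_iff_mul_eq]
  ext x j
  · rw [hf, wreathHom_apply]
  · rw [hf, wreathHom_apply]
    simp

/-- The automorphism group of `A × (ι → L)`. -/
theorem nonempty_aut_prod_pow_mulEquiv [WellFoundedGT A] (hL : IsClaw L)
    (hA : ∀ (B : Type u) [PartialOrder B] [OrderTop B], IsEmpty (A ≃o B × L)) (θ : H ≃* Aut L) :
    Nonempty (Aut (A × (ι → L)) ≃*
      Aut A × SemidirectProduct (ι → H) (Equiv.Perm ι) mulAutArrow) :=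
  ⟨(MulEquiv.ofBijective (wreathHom A ι θ.toMonoidHom)
    ⟨wreathHom_injective hL θ.injective, wreathHom_surjective hL hA θ.surjective⟩).symm⟩

end PowerAutomorphisms

/-! ### Removing and restoring the least element -/

section RemoveBot

/-- A poset with a least element is obtained from its other elements by adding a least element. -/
noncomputable def withBotNeBot (X : Type*) [PartialOrder X] [OrderBot X] :
    WithBot {x : X // x ≠ ⊥} ≃o X := by
  classical exact WithBot.subtypeOrderIso

/-- Adding a least element does not change the automorphism group. -/
theorem nonempty_aut_withBot_mulEquiv (Z : Type*) [PartialOrder Z] :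
    Nonempty (Aut (WithBot Z) ≃* Aut Z) := by
  let F : Aut Z →* Aut (WithBot Z) :=
    { toFun := fun e => e.withBotCongr
      map_one' := OrderIso.withBotCongr_refl
      map_mul' := fun e f => OrderIso.withBotCongr_trans f e }
  refine ⟨(MulEquiv.ofBijective F ⟨fun e f h => ?_, fun φ => ?_⟩).symm⟩
  · ext z
    exact WithBot.coe_injective (DFunLike.congr_fun h (z : WithBot Z))
  · have h1 : ∀ z : Z, φ z ≠ ⊥ := fun z h => by
      rw [map_eq_bot_iff] at h
      exact WithBot.coe_ne_bot h
    have h2 : ∀ z : Z, φ.symm z ≠ ⊥ := fun z h => by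
      rw [map_eq_bot_iff] at h
      exact WithBot.coe_ne_bot h
    let e : Aut Z :=
      { toFun := fun z => (φ z).unbot (h1 z)
        invFun := fun z => (φ.symm z).unbot (h2 z)
        left_inv := fun z => WithBot.coe_injective (by simp)
        right_inv := fun z => WithBot.coe_injective (by simp)
        map_rel_iff' := fun {a b} => by
          rw [← WithBot.coe_le_coe]
          simp }
    refine ⟨e, ?_⟩
    refine DFunLike.ext _ _ fun x => ?_
    induction x with
    | bot => exact (map_bot φ).symm
    | coe z => exact WithBot.coe_unbot _ (h1 z)

theorem nonempty_aut_mulEquiv_of_orderIso {X Y : Type*} [PartialOrder X] [PartialOrder Y]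
    (e : X ≃o Y) : Nonempty (Aut X ≃* Aut Y) :=
  ⟨{ toFun := fun φ => e.symm.trans (φ.trans e)
     invFun := fun φ => e.trans (φ.trans e.symm)
     left_inv := fun φ => by ext; simp
     right_inv := fun φ => by ext; simp
     map_mul' := fun φ ψ => by ext; simp }⟩

theorem nonempty_aut_mulEquiv_aut_ne_bot (X : Type*) [PartialOrder X] [OrderBot X] :
    Nonempty (Aut X ≃* Aut {x : X // x ≠ ⊥}) := by
  obtain ⟨e⟩ := nonempty_aut_mulEquiv_of_orderIso (withBotNeBot X)
  obtain ⟨f⟩ := nonempty_aut_withBot_mulEquiv {x : X // x ≠ ⊥}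
  exact ⟨e.symm.trans f⟩

/-- The elements of `WithBot B` different from the least one. -/
def withBotNeBotOrderIso (B : Type*) [PartialOrder B] : B ≃o {x : WithBot B // x ≠ ⊥} where
  toFun b := ⟨b, WithBot.coe_ne_bot⟩
  invFun x := x.1.unbot x.2
  left_inv _ := rfl
  right_inv _ := Subtype.ext (WithBot.coe_unbot _ _)
  map_rel_iff' := WithBot.coe_le_coe

end RemoveBot

section Cartesian

instance {P : Type u} {Q : Type v} [PartialOrder P] [PartialOrder Q] [OrderBot P] [OrderBot Q] :
    OrderBot (CartProd P Q) where
  bot := ⟨(⊥, ⊥), Or.inr rfl⟩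
  bot_le x := (bot_le : (⊥ : P × Q) ≤ x.1)

instance {P : Type u} [PartialOrder P] [OrderBot P] (k : ℕ) : OrderBot (CartPow P k) where
  bot_le x := (bot_le : (⊥ : Fin k → P) ≤ x.1)

/-- Without the least elements, the Cartesian product is the product of posets. -/
def cartProdNeBotOrderIso (P : Type u) (Q : Type v) [PartialOrder P] [PartialOrder Q]
    [OrderBot P] [OrderBot Q] :
    {x : CartProd P Q // x ≠ ⊥} ≃o {p : P // p ≠ ⊥} × {q : Q // q ≠ ⊥} where
  toFun x :=
    have h := x.1.2.resolve_right fun h => x.2 (Subtype.ext h)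
    (⟨x.1.1.1, h.1⟩, ⟨x.1.1.2, h.2⟩)
  invFun y := ⟨⟨(y.1, y.2), Or.inl ⟨y.1.2, y.2.2⟩⟩, fun h =>
    y.1.2 (congrArg (fun z : CartProd P Q => z.1.1) h)⟩
  left_inv _ := rfl
  right_inv _ := rfl
  map_rel_iff' := Iff.rfl

/-- Without the least elements, the Cartesian power is the power of posets. -/
def cartPowNeBotOrderIso (P : Type u) [PartialOrder P] [OrderBot P] {k : ℕ} (hk : 1 ≤ k) :
    {x : CartPow P k // x ≠ ⊥} ≃o (Fin k → {p : P // p ≠ ⊥}) where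
  toFun x i := ⟨x.1.1 i, (x.1.2.resolve_right fun h => x.2 (Subtype.ext h)) i⟩
  invFun y := ⟨⟨fun i => y i, Or.inl fun i => (y i).2⟩, fun h =>
    (y ⟨0, hk⟩).2 (congrArg (fun z : CartPow P k => z.1 ⟨0, hk⟩) h)⟩
  left_inv _ := rfl
  right_inv _ := rfl
  map_rel_iff' := Iff.rfl

end Cartesian

/-! ### The point and the edge as claws -/

section PtEdge

theorem isClaw_pt : IsClaw Pt := ⟨⟨⊥, by decide⟩, by decide⟩

instance : Subsingleton (Aut Pt) := by
  have h : ∀ x : Pt, x = ⊥ ∨ x = ⊤ := by decide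
  refine ⟨fun f g => DFunLike.ext _ _ fun x => ?_⟩
  rcases h x with rfl | rfl
  · rw [map_bot, map_bot]
  · rw [map_top, map_top]

/-- The nonempty faces of the polytope of rank `1`. -/
abbrev EdgeFace : Type := {e : Edge // e ≠ ⊥}

instance {P : Type*} [PartialOrder P] [BoundedOrder P] [Nontrivial P] :
    OrderTop {p : P // p ≠ ⊥} where
  top := ⟨⊤, top_ne_bot⟩
  le_top x := (le_top : x.1 ≤ ⊤)

theorem isClaw_edgeFace : IsClaw EdgeFace := ⟨⟨⟨{0}, by decide⟩, by decide⟩, by decide⟩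

/-- The reversal of the edge. -/
def edgeFaceSwap : Aut EdgeFace where
  toFun e := ⟨e.1.map (Equiv.swap 0 1).toEmbedding, by simpa using e.2⟩
  invFun e := ⟨e.1.map (Equiv.swap 0 1).toEmbedding, by simpa using e.2⟩
  left_inv := by decide
  right_inv := by decide
  map_rel_iff' := by decide

theorem nonempty_mulEquiv_aut_edgeFace :
    Nonempty (Multiplicative (ZMod 2) ≃* Aut EdgeFace) := by
  have : Nat.card (Aut EdgeFace) = 2 := by
    rw [Nat.card_eq_two_iff]
    have hx : ∀ x : EdgeFace, x = ⟨{0}, by decide⟩ ∨ x = ⟨{1}, by decide⟩ ∨ x = ⊤ := by decide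
    have h0 : (⟨{0}, by decide⟩ : EdgeFace) ≠ ⊤ := by decide
    have h1 : (⟨{1}, by decide⟩ : EdgeFace) ≠ ⊤ := by decide
    have h01 : (⟨{0}, by decide⟩ : EdgeFace) ≠ ⟨{1}, by decide⟩ := by decide
    have hs0 : edgeFaceSwap ⟨{0}, by decide⟩ = ⟨{1}, by decide⟩ := by decide
    have hs1 : edgeFaceSwap ⟨{1}, by decide⟩ = ⟨{0}, by decide⟩ := by decide
    generalize (⟨{0}, by decide⟩ : EdgeFace) = a at *
    generalize (⟨{1}, by decide⟩ : EdgeFace) = b at *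
    refine ⟨1, edgeFaceSwap, fun h => ?_, Set.eq_univ_of_forall fun φ => ?_⟩
    · rw [← h] at hs0
      exact h01 hs0
    · have ha : φ a ≠ ⊤ := by rwa [Ne, map_eq_top_iff]
      have hb : φ b ≠ ⊤ := by rwa [Ne, map_eq_top_iff]
      have hab : φ a ≠ φ b := φ.injective.ne h01
      rcases hx (φ a) with h | h | h
      · have h' : φ b = b := by
          rcases hx (φ b) with h' | h' | h'
          · exact absurd (h.trans h'.symm) hab
          · exact h'
          · exact absurd h' hb
        refine Or.inl (DFunLike.ext _ _ fun x => ?_)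
        rcases hx x with rfl | rfl | rfl
        · exact h
        · exact h'
        · exact map_top φ
      · have h' : φ b = a := by
          rcases hx (φ b) with h' | h' | h'
          · exact h'
          · exact absurd (h.trans h'.symm) hab
          · exact absurd h' hb
        refine Or.inr (DFunLike.ext _ _ fun x => ?_)
        rcases hx x with rfl | rfl | rfl
        · rw [h, hs0]
        · rw [h', hs1]
        · rw [map_top, map_top]
      · exact absurd h ha
  have : Fact (Nat.Prime 2) := ⟨Nat.prime_two⟩
  exact ⟨mulEquivOfPrimeCardEq (p := 2) (by simp) ‹_›⟩

end PtEdge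

/-! ### From a splitting of posets to a pyramid or prism over a polytope -/

section Main

variable {P : Type u} [PartialOrder P] [BoundedOrder P] {n : ℤ}

/-- The factor `B` is a polytope because it is the lower interval under `(⊤, ⊥)`, the base of the
pyramid. -/
theorem IsAbstractPolytope.isPyramid_of_orderIso (hP : IsAbstractPolytope P n) {B : Type u}
    [PartialOrder B] [OrderTop B] (e : P ≃o B × Pt) : IsPyramid P := by
  let _ : BoundedOrder B :=
    { bot := (e ⊥).1
      bot_le := fun b => ((e.le_symm_apply).1 (bot_le : ⊥ ≤ e.symm (b, ⊥))).1 }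
  let i : B ↪o P := (OrderEmbedding.ofMapLEIff (fun b => ((b, ⊥) : B × Pt))
    fun a b => by simp).trans e.symm.toOrderEmbedding
  have hi : IsLowerSet (Set.range i) := by
    rintro _ x hx ⟨b, rfl⟩
    have h : e x ≤ (b, ⊥) := (e.le_symm_apply).1 hx
    refine ⟨(e x).1, (e.symm_apply_eq).2 (Prod.ext rfl (le_bot_iff.1 h.2).symm)⟩
  obtain ⟨m, hm⟩ := hP.exists_of_isLowerSet_range i hi
  exact ⟨B, _, _, m, hm, ⟨e⟩⟩

/-- Restoring a least element makes `WithBot B` the lower interval of `P` under `(⊤, d)`, one of the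
two ends of the prism. -/
theorem IsAbstractPolytope.isPrism_of_orderIso (hP : IsAbstractPolytope P n) {B : Type u}
    [PartialOrder B] [OrderTop B] (e : {p : P // p ≠ ⊥} ≃o B × EdgeFace) : IsPrism P := by
  let e' : WithBot (B × EdgeFace) ≃o P := e.symm.withBotCongr.trans (withBotNeBot P)
  let d : EdgeFace := ⟨{0}, by decide⟩
  have hd : d ≠ ⊤ := by decide
  let j : B ↪o B × EdgeFace := OrderEmbedding.ofMapLEIff (fun b => (b, d)) fun a b => by simp
  let i : WithBot B ↪o P := j.withBotMap.trans e'.toOrderEmbedding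
  have hi : IsLowerSet (Set.range i) := by
    rintro _ x hx ⟨b, rfl⟩
    obtain ⟨y, rfl⟩ := e'.surjective x
    have h : y ≤ WithBot.map j b := (e'.le_iff_le).1 hx
    induction y with
    | bot => exact ⟨⊥, rfl⟩
    | coe y =>
      induction b with
      | bot => exact absurd (le_bot_iff.1 h) WithBot.coe_ne_bot
      | coe b =>
        have h' : y ≤ (b, d) := WithBot.coe_le_coe.1 h
        refine ⟨(y.1 : WithBot B), congrArg (fun z : B × EdgeFace => e' z) ?_⟩
        exact Prod.ext rfl (isClaw_edgeFace.eq_of_le h'.2 hd).symm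
  obtain ⟨m, hm⟩ := hP.exists_of_isLowerSet_range i hi
  refine ⟨WithBot B, _, _, m, hm, ⟨e'.symm.trans ?_⟩⟩
  exact ((prodCongr (withBotNeBotOrderIso B) (OrderIso.refl EdgeFace)).trans
    (cartProdNeBotOrderIso (WithBot B) Edge).symm).withBotCongr.trans
      (withBotNeBot (CartProd (WithBot B) Edge))

/-- In rank `-1` the product with the edge has only the pair of least elements, so `P` is a prism
over itself. -/
theorem IsAbstractPolytope.isPrism_of_subsingleton [Subsingleton P]
    (hP : IsAbstractPolytope P n) : IsPrism P := by
  have : Subsingleton (CartProd P Edge) := ⟨fun x y => Subtype.ext (by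
    rw [x.2.resolve_left fun h => h.1 (Subsingleton.elim _ _),
      y.2.resolve_left fun h => h.1 (Subsingleton.elim _ _)])⟩
  exact ⟨P, _, _, n, hP, ⟨⟨⟨fun _ => ⊥, fun _ => ⊥, fun _ => Subsingleton.elim _ _,
    fun _ => Subsingleton.elim _ _⟩, fun {a b} => by
      simp [Subsingleton.elim a b]⟩⟩⟩

end Main

end AbsPolytope

open AbsPolytope in
theorem mainTheorem2 {P : Type u} [PartialOrder P] [BoundedOrder P] (n : ℤ)
    (hP : AbsPolytope.IsAbstractPolytope P n) :
    (¬ AbsPolytope.IsPyramid P → ∀ k : ℕ, 1 ≤ k →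
      Nonempty (AbsPolytope.Aut (AbsPolytope.Join P (AbsPolytope.JoinPow AbsPolytope.Pt k)) ≃*
        AbsPolytope.Aut P × Equiv.Perm (Fin k))) ∧
    (¬ AbsPolytope.IsPrism P → ∀ k : ℕ, 1 ≤ k →
      Nonempty (AbsPolytope.Aut (AbsPolytope.CartProd P (AbsPolytope.CartPow AbsPolytope.Edge k)) ≃*
        AbsPolytope.Aut P × AbsPolytope.SignedPerm k)) := by
  have := hP.wellFoundedGT
  refine ⟨fun h k _ => ?_, fun h k hk => ?_⟩
  · obtain ⟨e⟩ := nonempty_aut_prod_pow_mulEquiv (A := P) (ι := Fin k) isClaw_pt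
      (fun B _ _ => ⟨fun e => h (hP.isPyramid_of_orderIso e)⟩) (MulEquiv.refl (Aut Pt))
    -- `Aut Pt` is trivial, so the wreath product collapses to `Sym(k)`.
    refine ⟨e.trans (MulEquiv.prodCongr (MulEquiv.refl _)
      (MulEquiv.ofBijective SemidirectProduct.rightHom
        ⟨fun a b hab => SemidirectProduct.ext (Subsingleton.elim _ _) hab,
          SemidirectProduct.rightHom_surjective⟩))⟩
  · rcases subsingleton_or_nontrivial P with hs | hs
    -- A one-element `P` would leave nothing after removing `⊥`, not even a top; it is excluded as a
    -- prism.
    · exact absurd hP.isPrism_of_subsingleton h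
    obtain ⟨θ⟩ := nonempty_mulEquiv_aut_edgeFace
    have : WellFoundedGT {p : P // p ≠ ⊥} :=
      (Subtype.strictMono_coe fun p : P => p ≠ ⊥).wellFoundedGT
    obtain ⟨e₁⟩ := nonempty_aut_prod_pow_mulEquiv (A := {p : P // p ≠ ⊥}) (ι := Fin k)
      isClaw_edgeFace (fun B _ _ => ⟨fun e => h (hP.isPrism_of_orderIso e)⟩) θ
    obtain ⟨e₂⟩ := nonempty_aut_mulEquiv_aut_ne_bot (CartProd P (CartPow Edge k))
    obtain ⟨e₃⟩ := nonempty_aut_mulEquiv_of_orderIso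
      ((cartProdNeBotOrderIso P (CartPow Edge k)).trans
        (prodCongr (OrderIso.refl {p : P // p ≠ ⊥}) (cartPowNeBotOrderIso Edge hk)))
    obtain ⟨e₄⟩ := nonempty_aut_mulEquiv_aut_ne_bot P
    exact ⟨e₂.trans (e₃.trans (e₁.trans (MulEquiv.prodCongr e₄.symm (MulEquiv.refl _))))⟩
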